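/- Let $T,\nu,\sigma>0$, $-\infty<u_l\le u_u<\infty$, $H=L^2(\mathbb R)$, $V=H^1(\mathbb R)$, and $W(V)=\{y\in L^2(0,T;V): \partial_t y\in L^2(0,T;V^*)\}$ (so that $y\in C([0,T];H)$). Let $\chi_c\in C_0^\infty(\mathbb R)$, let $y_0\in V$ and $y_d\in H$ have compact support, and put $$U_{ad}=\{u\in H^1(0,T): u_l\le u(t)\le u_u \text{ a.e.}\},\qquad J(y,u)=\tfrac12\|y(T)-y_d\|_H^2+\tfrac\sigma2\|u\|_{H^1(0,T)}^2 .$$ $(\mathcal P)$: minimise $J(y,u)$ over $(y,u)\in W(V)\times U_{ad}$ subject to the weak viscous Burgers equation: $y(0)=y_0$ in $H$ and, for a.e. $t\in(0,T)$ and all $\phi\in V$, $$\langle \partial_t y(t),\phi\rangle_{V^*,V}+\langle y(t)\partial_x y(t),\phi\rangle_H+\nu\langle\partial_x y(t),\partial_x\phi\rangle_H=u(t)\langle \chi_c,\phi\rangle_H. \tag{1}$$ $(\mathcal P_h)$: Let $h>0$. A particle discretisation consists of initial points $X_1<\dots<X_N$ with consecutive distances at most $h$, a smoothing length $\varepsilon>0$,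 and a kernel $\delta_\varepsilon(x)=\varepsilon^{-1}\zeta(x/\varepsilon)$, where $\zeta\in C^\infty(\mathbb R)\cap L^1(\mathbb R)\cap H^1(\mathbb R)$, $\int\zeta=1$ and, for some integer $r\ge1$, $\int x^k\zeta(x)\,dx=0$ for $1\le k\le r-1$ and $\int|x|^r|\zeta(x)|\,dx<\infty$; and, for each vector of positions $\xi\in\mathbb R^N$, a space of test functions $\mathcal T(\xi)$ with $\operatorname{span}\{\delta_\varepsilon(\cdot-\xi_i)\}_{i=1}^N\subseteq\mathcal T(\xi)\subseteq V$ (for example the span itself, or $V$). A discrete state for $u\in U_{ad}$ is a pair $(y_h,\Phi)$ with $y_h\in W(V)\cap L^\infty(0,T;V)$, $\Phi\in H^1(0,T)^N$, such that for all $t\in[0,T]$ $$y_h(x,t)=\sum_{i=1}^N\alpha_i(t)\,\delta_\varepsilon(x-\Phi_i(t))$$ for some coefficients $\alpha_i(t)\in\mathbb R$, with $\partial_t\Phi_i(t)=y_h(\Phi_i(t),t)$, $\Phi_i(0)=X_i$, such that (1) holds with $y=y_h$ for a.e. $t$ and all $\phi\in\mathcal T(\Phi(t))$, and $\langle y_h(0),\psi\rangle_H=\langle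 y_0,\psi\rangle_H$ for all $\psi\in\mathcal T(X)$. The problem $(\mathcal P_h)$ is to minimise $J(y_h,u)$ over all $u\in U_{ad}$ and all discrete states $(y_h,\Phi)$ for $u$. Only discretisations for which every $u\in U_{ad}$ has a discrete state are considered. **Lemma.** There is a constant $C>0$, independent of $h$ (and of the discretisation), such that $$\|u\|_{H^1(0,T)}\le C\qquad\text{and}\qquad\|u_h\|_{H^1(0,T)}\le C$$ for every optimal control $u\in U_{ad}$ of $(\mathcal P)$ and every optimal control $u_h\in U_{ad}$ of any such problem $(\mathcal P_h)$. -/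

import Mathlib

open MeasureTheory Set
open scoped ContDiff ENNReal

noncomputable section

namespace BurgersControl

/-- A test function: smooth with compact support contained in `Ω`. -/
def IsTestFun (Ω : Set ℝ) (θ : ℝ → ℝ) : Prop :=
  ContDiff ℝ ∞ θ ∧ HasCompactSupport θ ∧ tsupport θ ⊆ Ω

/-- A test function is square integrable. -/
lemma IsTestFun.memLp {Ω : Set ℝ} {θ : ℝ → ℝ} (h : IsTestFun Ω θ)
    (μ : Measure ℝ) [IsFiniteMeasureOnCompacts μ] : MemLp θ 2 μ :=
  h.1.continuous.memLp_of_hasCompactSupport h.2.1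

/-- The derivative of a test function is square integrable. -/
lemma IsTestFun.memLp_deriv {Ω : Set ℝ} {θ : ℝ → ℝ} (h : IsTestFun Ω θ)
    (μ : Measure ℝ) [IsFiniteMeasureOnCompacts μ] : MemLp (deriv θ) 2 μ :=
  (h.1.continuous_deriv (by simp)).memLp_of_hasCompactSupport h.2.1.deriv

/-- The pairs `(f, g)` in `L² × L²` such that `g` is the weak derivative of `f` on the open set
`Ω ⊆ ℝ`, where `μ` is Lebesgue measure on `Ω`. -/
def H1Submodule (Ω : Set ℝ) (μ : Measure ℝ) [IsFiniteMeasureOnCompacts μ] :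
    Submodule ℝ (WithLp 2 (Lp ℝ 2 μ × Lp ℝ 2 μ)) where
  carrier := {w | ∀ θ : ℝ → ℝ, IsTestFun Ω θ →
    ∫ x, w.fst x * deriv θ x ∂μ = - ∫ x, w.snd x * θ x ∂μ}
  zero_mem' := by
    intro θ _
    have h : ∀ ψ : ℝ → ℝ, ∫ x, ((0 : Lp ℝ 2 μ) : ℝ → ℝ) x * ψ x ∂μ = 0 := by
      intro ψ
      refine integral_eq_zero_of_ae ?_
      filter_upwards [Lp.coeFn_zero ℝ 2 μ] with x hx
      rw [hx]
      simp
    simp only [WithLp.zero_fst, WithLp.zero_snd]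
    rw [h, h, neg_zero]
  add_mem' := by
    intro a b ha hb θ hθ
    have key : ∀ (f g : Lp ℝ 2 μ) (ψ : ℝ → ℝ), MemLp ψ 2 μ →
        ∫ x, (f + g : Lp ℝ 2 μ) x * ψ x ∂μ = ∫ x, f x * ψ x ∂μ + ∫ x, g x * ψ x ∂μ := by
      intro f g ψ hψ
      have hf : Integrable (fun x => f x * ψ x) μ := (Lp.memLp f).integrable_mul hψ
      have hg : Integrable (fun x => g x * ψ x) μ := (Lp.memLp g).integrable_mul hψ
      rw [← integral_add hf hg]
      refine integral_congr_ae ?_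
      filter_upwards [Lp.coeFn_add f g] with x hx
      rw [hx, Pi.add_apply, add_mul]
    have h1 := ha θ hθ
    have h2 := hb θ hθ
    simp only [WithLp.add_fst, WithLp.add_snd]
    rw [key _ _ _ (hθ.memLp_deriv μ), key _ _ _ (hθ.memLp μ), h1, h2]
    ring
  smul_mem' := by
    intro c a ha θ hθ
    have key : ∀ (f : Lp ℝ 2 μ) (ψ : ℝ → ℝ),
        ∫ x, (c • f : Lp ℝ 2 μ) x * ψ x ∂μ = c * ∫ x, f x * ψ x ∂μ := by
      intro f ψ
      rw [← integral_const_mul]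
      refine integral_congr_ae ?_
      filter_upwards [Lp.coeFn_smul c f] with x hx
      simp [hx, mul_assoc]
    have h1 := ha θ hθ
    simp only [WithLp.smul_fst, WithLp.smul_snd]
    rw [key, key, h1]
    ring

/-- The Sobolev space `H¹(Ω)` of real functions on the open set `Ω ⊆ ℝ`, where `μ` is Lebesgue
measure on `Ω`; an element is a function together with its weak derivative. -/
def H1Space (Ω : Set ℝ) (μ : Measure ℝ) [IsFiniteMeasureOnCompacts μ] : Type :=
  H1Submodule Ω μ

section H1Space

variable {Ω : Set ℝ} {μ : Measure ℝ} [IsFiniteMeasureOnCompacts μ]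

instance : NormedAddCommGroup (H1Space Ω μ) :=
  inferInstanceAs (NormedAddCommGroup (H1Submodule Ω μ))

instance : InnerProductSpace ℝ (H1Space Ω μ) :=
  inferInstanceAs (InnerProductSpace ℝ (H1Submodule Ω μ))

/-- The function underlying an element of `H¹`. -/
def val (v : H1Space Ω μ) : Lp ℝ 2 μ := (Subtype.val (p := fun w => w ∈ H1Submodule Ω μ) v).fst

/-- The weak derivative of an element of `H¹`. -/
def weakDeriv (v : H1Space Ω μ) : Lp ℝ 2 μ :=
  (Subtype.val (p := fun w => w ∈ H1Submodule Ω μ) v).snd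

/-- The inner product of `H¹`. -/
lemma inner_eq (v w : H1Space Ω μ) :
    inner ℝ v w = inner ℝ (val v) (val w) + inner ℝ (weakDeriv v) (weakDeriv w) :=
  WithLp.prod_inner_apply (𝕜 := ℝ) (E := Lp ℝ 2 μ) (F := Lp ℝ 2 μ) _ _

/-- The norm of `H¹`. -/
lemma norm_sq_eq (v : H1Space Ω μ) : ‖v‖ ^ 2 = ‖val v‖ ^ 2 + ‖weakDeriv v‖ ^ 2 :=
  WithLp.prod_norm_sq_eq_of_L2 (α := Lp ℝ 2 μ) (β := Lp ℝ 2 μ) _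

end H1Space

/-- `H = L²(ℝ)`. -/
abbrev H : Type := Lp ℝ 2 (volume : Measure ℝ)

/-- `V = H¹(ℝ)`. -/
abbrev V : Type := H1Space univ (volume : Measure ℝ)

/-- Lebesgue measure on the time interval `(0, T)`. -/
abbrev timeMeasure (T : ℝ) : Measure ℝ := volume.restrict (Ioo 0 T)

/-- `H¹(0, T)`. -/
abbrev H1Time (T : ℝ) : Type := H1Space (Ioo 0 T) (timeMeasure T)

/-- An element `y` of `W(V) = {y ∈ L²(0,T;V) | ∂ₜ y ∈ L²(0,T;V*)}`, given together with its
weak time derivative (with respect to the triple `V ⊆ H = H* ⊆ V*`) and its continuous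
representative `[0,T] → H`, through which the values at the times `0` and `T` are defined. -/
structure W (T : ℝ) where
  /-- the function `t ↦ y(t) ∈ V`, defined for almost every `t ∈ (0,T)` -/
  toV : ℝ → V
  /-- the weak time derivative `t ↦ ∂ₜ y(t) ∈ V*` -/
  dt : ℝ → (V →L[ℝ] ℝ)
  /-- the representative in `C([0,T]; H)` -/
  traj : ℝ → H
  memLp_toV : MemLp toV 2 (timeMeasure T)
  memLp_dt : MemLp dt 2 (timeMeasure T)
  weak_dt : ∀ (v : V) (θ : ℝ → ℝ), IsTestFun (Ioo 0 T) θ →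
    ∫ t, inner ℝ (val (toV t)) (val v) * deriv θ t ∂(timeMeasure T) =
      - ∫ t, dt t v * θ t ∂(timeMeasure T)
  continuousOn_traj : ContinuousOn traj (Icc 0 T)
  traj_eq : ∀ᵐ t ∂(timeMeasure T), traj t = val (toV t)

/-- The data of the optimal control problem. -/
structure ControlProblem where
  /-- final time -/
  T : ℝ
  /-- viscosity -/
  ν : ℝ
  /-- regularisation parameter -/
  σ : ℝ
  /-- lower bound of the controls -/
  ul : ℝ
  /-- upper bound of the controls -/
  uu : ℝ
  /-- spatial localisation function -/
  χ : ℝ → ℝ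
  /-- initial value -/
  y0 : V
  /-- desired final state -/
  yd : H
  T_pos : 0 < T
  ν_pos : 0 < ν
  σ_pos : 0 < σ
  ul_le_uu : ul ≤ uu
  χ_smooth : ContDiff ℝ ∞ χ
  χ_supp : HasCompactSupport χ
  y0_supp : ∃ K : Set ℝ, IsCompact K ∧ ∀ᵐ x : ℝ, x ∉ K → val y0 x = 0
  yd_supp : ∃ K : Set ℝ, IsCompact K ∧ ∀ᵐ x : ℝ, x ∉ K → yd x = 0

namespace ControlProblem

variable (P : ControlProblem)

/-- The set of admissible controls. -/
def Uad : Set (H1Time P.T) :=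
  {u | ∀ᵐ t ∂(timeMeasure P.T), P.ul ≤ val u t ∧ val u t ≤ P.uu}

/-- The cost functional `½ ‖y(T) - y_d‖² + (σ/2) ‖u‖²`, with the norms of `H` and `H¹(0,T)`. -/
def J (y : W P.T) (u : H1Time P.T) : ℝ :=
  1 / 2 * ‖y.traj P.T - P.yd‖ ^ 2 + P.σ / 2 * ‖u‖ ^ 2

/-- The weak viscous Burgers equation at time `t`, tested with `φ ∈ V`:
`⟨∂ₜ y, φ⟩ + ⟨y ∂ₓ y, φ⟩ + ν ⟨∂ₓ y, ∂ₓ φ⟩ = ⟨χ u(t), φ⟩`. -/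
def BurgersAt (y : W P.T) (u : H1Time P.T) (t : ℝ) (φ : V) : Prop :=
  y.dt t φ + (∫ x, val (y.toV t) x * weakDeriv (y.toV t) x * val φ x)
      + P.ν * inner ℝ (weakDeriv (y.toV t)) (weakDeriv φ)
    = val u t * ∫ x, P.χ x * val φ x

/-- `y ∈ W(V)` is the weak solution of the viscous Burgers equation with control `u`. -/
def IsState (y : W P.T) (u : H1Time P.T) : Prop :=
  (∀ᵐ t ∂(timeMeasure P.T), ∀ φ : V, P.BurgersAt y u t φ) ∧
    ∀ ψ : H, inner ℝ (y.traj 0) ψ = inner ℝ (val P.y0) ψ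

/-- `(y, u)` solves the continuous problem: it minimises `J` over all
`(y, u) ∈ W(V) × U_ad` such that `y` is the state of `u`. -/
def IsSolution (y : W P.T) (u : H1Time P.T) : Prop :=
  u ∈ P.Uad ∧ P.IsState y u ∧
    ∀ (y' : W P.T) (u' : H1Time P.T), u' ∈ P.Uad → P.IsState y' u' → P.J y u ≤ P.J y' u'

end ControlProblem

/-- The dilated kernel `δ_ε(x) = ε⁻¹ ζ(ε⁻¹ x)`. -/
def dilate (ζ : ℝ → ℝ) (ε x : ℝ) : ℝ := ε⁻¹ * ζ (ε⁻¹ * x)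

/-- The particle function `∑ᵢ aᵢ δ(x - ξᵢ)` with kernel `δ`, coefficients `a`, positions `ξ`. -/
def particleFun {N : ℕ} (δ : ℝ → ℝ) (a ξ : Fin N → ℝ) (x : ℝ) : ℝ :=
  ∑ i, a i * δ (x - ξ i)

/-- A particle discretisation with initial point distance (at most) `h`. -/
structure ParticleScheme (h : ℝ) where
  /-- number of particles -/
  N : ℕ
  /-- initial particle positions -/
  X : Fin N → ℝ
  strictMono_X : StrictMono X
  spacing : ∀ i j : Fin N, (j : ℕ) = (i : ℕ) + 1 → X j - X i ≤ h
  /-- smoothing kernel -/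
  ζ : ℝ → ℝ
  ζ_smooth : ContDiff ℝ ∞ ζ
  ζ_memLp_one : MemLp ζ 1
  ζ_memLp : MemLp ζ 2
  ζ_memLp_deriv : MemLp (deriv ζ) 2
  ζ_integral : ∫ x, ζ x = 1
  /-- order of the moment conditions -/
  r : ℕ
  one_le_r : 1 ≤ r
  ζ_moment : ∀ k : ℕ, 1 ≤ k → k < r → ∫ x, x ^ k * ζ x = 0
  ζ_integrable : Integrable (fun x => |x| ^ r * |ζ x|)
  /-- smoothing length -/
  ε : ℝ
  ε_pos : 0 < ε
  /-- the space of test functions used when the particles are at the positions `ξ`: any subspace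
  of `V` that contains all particle functions, for example `V` itself or only their span -/
  test : (Fin N → ℝ) → Submodule ℝ V
  particle_mem_test : ∀ (a ξ : Fin N → ℝ) (v : V),
    (val v : ℝ → ℝ) =ᵐ[volume] particleFun (dilate ζ ε) a ξ → v ∈ test ξ

namespace ControlProblem

variable (P : ControlProblem) {h : ℝ} (S : ParticleScheme h)

/-- `(y, Φ)` is the discrete state for the control `u`: `y ∈ W(V) ∩ L^∞(0,T;V)` is a particle
function `y(x,t) = ∑ᵢ αᵢ(t) δ_ε(x - Φᵢ(t))`; the particle paths `Φᵢ ∈ H¹(0,T)` start at `Xᵢ` and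
satisfy `∂ₜ Φᵢ(t) = y(Φᵢ(t), t)` (written as an integral equation with a right-hand side in
`L²(0,T)`); and the weak Burgers equation and the initial condition hold for the test functions
of the scheme. -/
def IsDiscreteState (y : W P.T) (Φ : Fin S.N → ℝ → ℝ) (u : H1Time P.T) : Prop :=
  MemLp y.toV ∞ (timeMeasure P.T) ∧
  (∃ α : Fin S.N → ℝ → ℝ,
    (∀ t ∈ Icc 0 P.T, (y.traj t : ℝ → ℝ) =ᵐ[volume]
      particleFun (dilate S.ζ S.ε) (fun i => α i t) (fun i => Φ i t)) ∧
    ∀ i,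
      MemLp (fun t => particleFun (dilate S.ζ S.ε) (fun j => α j t) (fun j => Φ j t) (Φ i t)) 2
        (timeMeasure P.T) ∧
      ∀ t ∈ Icc 0 P.T, Φ i t = S.X i +
        ∫ s in (0 : ℝ)..t,
          particleFun (dilate S.ζ S.ε) (fun j => α j s) (fun j => Φ j s) (Φ i s)) ∧
  (∀ᵐ t ∂(timeMeasure P.T), ∀ φ ∈ S.test (fun i => Φ i t), P.BurgersAt y u t φ) ∧
  ∀ ψ ∈ S.test S.X, inner ℝ (y.traj 0) (val ψ) = inner ℝ (val P.y0) (val ψ)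

/-- Every admissible control has a discrete state. -/
def DiscreteSolvable : Prop :=
  ∀ u ∈ P.Uad, ∃ (y : W P.T) (Φ : Fin S.N → ℝ → ℝ), P.IsDiscreteState S y Φ u

/-- `(y, Φ, u)` solves the discrete problem: it minimises `J(y, u)` over all `u ∈ U_ad` and all
discrete states `(y, Φ)` for `u`. -/
def IsDiscreteSolution (y : W P.T) (Φ : Fin S.N → ℝ → ℝ) (u : H1Time P.T) : Prop :=
  u ∈ P.Uad ∧ P.IsDiscreteState S y Φ u ∧
    ∀ (y' : W P.T) (Φ' : Fin S.N → ℝ → ℝ) (u' : H1Time P.T),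
      u' ∈ P.Uad → P.IsDiscreteState S y' Φ' u' → P.J y u ≤ P.J y' u'

end ControlProblem

end BurgersControl

end

/-!
The cost dominates `σ / 2 * ‖u‖ ^ 2`, so it suffices to bound the optimal costs independently of
the discretisation, and for this it suffices to bound the cost of one constant control.

A particle solution `y` lies in its own test space, so the discrete Burgers equation may be tested
with `φ = y`. The convection term `∫ y² ∂ₓy = ⅓ ∫ ∂ₓ(y³)` vanishes and the viscous term has the
good sign, which leaves `½ d/dt ‖y‖² ≤ m ‖χ‖ ‖y‖` with `m = max(|u_l|, |u_u|)`. As `‖y(0)‖ ≤ ‖y₀‖`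
by projection, `‖y(T)‖` is bounded by the data of the continuous problem alone.

The energy identity `‖y(t)‖² - ‖y(0)‖² = 2 ∫₀ᵗ ⟨∂ₜy, y⟩` holds since
`‖y(τ + h)‖² - ‖y(τ)‖² = h ∫₀¹ ⟨∂ₜy(τ + h r), y(τ + h) + y(τ)⟩ dr`: divide by `h`, integrate over
`τ` and let `h → 0`, using that translations are continuous in `L²`.
-/

noncomputable section

namespace BurgersControl

open Filter Topology

section WeakDerivative

variable {Ω : Set ℝ} {μ : Measure ℝ} {f f' g g' θ ψ : ℝ → ℝ}

/-- `g` is the weak derivative of `f` on the open set `Ω ⊆ ℝ`. As for `H1Submodule`, `μ` stands for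
Lebesgue measure on `Ω`. -/
def HasWeakDeriv (Ω : Set ℝ) (μ : Measure ℝ) (f g : ℝ → ℝ) : Prop :=
  ∀ θ : ℝ → ℝ, IsTestFun Ω θ → ∫ x, f x * deriv θ x ∂μ = -∫ x, g x * θ x ∂μ

lemma HasWeakDeriv.congr_ae (h : HasWeakDeriv Ω μ f g) (hf : f =ᵐ[μ] f') (hg : g =ᵐ[μ] g') :
    HasWeakDeriv Ω μ f' g' := fun θ hθ => by
  have hfθ : ∫ x, f x * deriv θ x ∂μ = ∫ x, f' x * deriv θ x ∂μ :=
    integral_congr_ae (hf.mul (ae_eq_refl (deriv θ)))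
  have hgθ : ∫ x, g x * θ x ∂μ = ∫ x, g' x * θ x ∂μ := integral_congr_ae (hg.mul (ae_eq_refl θ))
  rw [← hfθ, ← hgθ, h θ hθ]

lemma IsTestFun.integrable [IsFiniteMeasureOnCompacts μ] (hθ : IsTestFun Ω θ) : Integrable θ μ :=
  hθ.1.continuous.integrable_of_hasCompactSupport hθ.2.1

protected lemma IsTestFun.deriv (hθ : IsTestFun Ω θ) : IsTestFun Ω (deriv θ) :=
  ⟨(contDiff_infty_iff_deriv.1 hθ.1).2, hθ.2.1.deriv, (tsupport_deriv_subset).trans hθ.2.2⟩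

lemma IsTestFun.eq_zero_of_notMem (hθ : IsTestFun Ω θ) {x : ℝ} (hx : x ∉ Ω) : θ x = 0 :=
  image_eq_zero_of_notMem_tsupport fun h => hx (hθ.2.2 h)

lemma IsTestFun.integrable_mul (hθ : IsTestFun Ω θ) (hf : LocallyIntegrableOn f Ω μ) :
    Integrable (fun x => f x * θ x) μ := by
  have hK : IsCompact (tsupport θ) := hθ.2.1
  have hsupp : Function.support (fun x => f x * θ x) ⊆ tsupport θ := fun x hx =>
    subset_tsupport θ (right_ne_zero_of_mul hx)
  exact (integrableOn_iff_integrable_of_support_subset hsupp).1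
    ((hf.integrableOn_compact_subset hθ.2.2 hK).mul_continuousOn hθ.1.continuous.continuousOn hK)

lemma HasWeakDeriv.sub (hfg : HasWeakDeriv Ω μ f g) (hfg' : HasWeakDeriv Ω μ f' g')
    (hf : LocallyIntegrableOn f Ω μ) (hf' : LocallyIntegrableOn f' Ω μ)
    (hg : LocallyIntegrableOn g Ω μ) (hg' : LocallyIntegrableOn g' Ω μ) :
    HasWeakDeriv Ω μ (f - f') (g - g') := fun θ hθ => by
  simp only [Pi.sub_apply, sub_mul]
  rw [integral_sub (hθ.deriv.integrable_mul hf) (hθ.deriv.integrable_mul hf'),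
    integral_sub (hθ.integrable_mul hg) (hθ.integrable_mul hg'), hfg θ hθ, hfg' θ hθ]
  ring

lemma ae_eq_of_forall_integral_mul_eq (hΩ : IsOpen Ω) (hg : LocallyIntegrableOn g Ω μ)
    (hg' : LocallyIntegrableOn g' Ω μ)
    (h : ∀ θ, IsTestFun Ω θ → ∫ x, g x * θ x ∂μ = ∫ x, g' x * θ x ∂μ) :
    ∀ᵐ x ∂μ, x ∈ Ω → g x = g' x := by
  have hzero := hΩ.ae_eq_zero_of_integral_contDiff_smul_eq_zero (hg.sub hg')
    fun θ hθ hθc hθΩ => by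
      have hθt : IsTestFun Ω θ := ⟨hθ, hθc, hθΩ⟩
      simp only [smul_eq_mul, mul_comm (θ _), Pi.sub_apply, sub_mul]
      rw [integral_sub (hθt.integrable_mul hg) (hθt.integrable_mul hg'), h θ hθt, sub_self]
  filter_upwards [hzero] with x hx hxΩ using sub_eq_zero.1 (hx hxΩ)

lemma HasWeakDeriv.ae_eq (hΩ : IsOpen Ω) (h : HasWeakDeriv Ω μ f g) (h' : HasWeakDeriv Ω μ f g')
    (hg : LocallyIntegrableOn g Ω μ) (hg' : LocallyIntegrableOn g' Ω μ) :
    ∀ᵐ x ∂μ, x ∈ Ω → g x = g' x :=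
  ae_eq_of_forall_integral_mul_eq hΩ hg hg' fun θ hθ =>
    neg_injective ((h θ hθ).symm.trans (h' θ hθ))

lemma hasWeakDeriv_deriv (Ω : Set ℝ) (hf : ContDiff ℝ 1 f) :
    HasWeakDeriv Ω (volume.restrict Ω) f (deriv f) := fun θ hθ => by
  have hf' : Continuous (deriv f) := hf.continuous_deriv le_rfl
  rw [setIntegral_eq_integral_of_forall_compl_eq_zero fun x hx => by
      rw [hθ.deriv.eq_zero_of_notMem hx, mul_zero],
    setIntegral_eq_integral_of_forall_compl_eq_zero fun x hx => by
      rw [hθ.eq_zero_of_notMem hx, mul_zero]]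
  exact integral_mul_deriv_eq_deriv_mul_of_integrable
    (fun x _ => (hf.differentiable one_ne_zero x).hasDerivAt)
    (fun x _ => (hθ.1.differentiable (by simp) x).hasDerivAt)
    (hθ.deriv.integrable_mul (hf.continuous.locallyIntegrable.locallyIntegrableOn Ω))
    (hθ.integrable_mul (hf'.locallyIntegrable.locallyIntegrableOn Ω))
    (hθ.integrable_mul (hf.continuous.locallyIntegrable.locallyIntegrableOn Ω))

lemma hasWeakDeriv_intervalIntegral {a b : ℝ} (hab : a ≤ b) {q : ℝ → ℝ}
    (hq : IntervalIntegrable q volume a b) :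
    HasWeakDeriv (Ioo a b) (volume.restrict (Ioo a b)) (fun x => ∫ s in a..x, q s) q := by
  intro θ hθ
  have hparts := (hq.absolutelyContinuousOnInterval_intervalIntegral
    left_mem_uIcc).integral_mul_deriv_eq_deriv_mul
    (hθ.1.of_le (by simp)).contDiffOn.absolutelyContinuousOnInterval
  have hderiv : ∫ x in a..b, deriv (fun x => ∫ s in a..x, q s) x * θ x =
      ∫ x in a..b, q x * θ x := by
    refine intervalIntegral.integral_congr_ae ?_
    filter_upwards [hq.ae_hasDerivAt_integral] with x hx hxab
    rw [(hx (uIoc_subset_uIcc hxab) a left_mem_uIcc).deriv]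
  rw [hderiv, hθ.eq_zero_of_notMem (fun h => h.1.false : a ∉ Ioo a b),
    hθ.eq_zero_of_notMem (fun h => h.2.false : b ∉ Ioo a b), mul_zero, mul_zero, sub_zero,
    zero_sub, intervalIntegral.integral_of_le hab, intervalIntegral.integral_of_le hab] at hparts
  simpa only [integral_Ioc_eq_integral_Ioo] using hparts

lemma IsTestFun.exists_tsupport_subset_Icc (hΩ : Ω.OrdConnected) (hθ : IsTestFun Ω θ) :
    ∃ c d, tsupport θ ⊆ Icc c d ∧ Icc c d ⊆ Ω := by
  rcases (tsupport θ).eq_empty_or_nonempty with hempty | hne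
  · exact ⟨1, 0, by simp [hempty], by simp⟩
  · obtain ⟨c, hc, hcle⟩ := hθ.2.1.isCompact.exists_isLeast hne
    obtain ⟨d, hd, hled⟩ := hθ.2.1.isCompact.exists_isGreatest hne
    exact ⟨c, d, fun x hx => ⟨hcle hx, hled hx⟩, hΩ.out (hθ.2.2 hc) (hθ.2.2 hd)⟩

lemma hasDerivAt_integral_Iic (hψ : Continuous ψ) (hint : Integrable ψ) (x : ℝ) :
    HasDerivAt (fun y => ∫ s in Iic y, ψ s) (ψ x) x := by
  have hprim : HasDerivAt (fun y => ∫ s in (0 : ℝ)..y, ψ s) (ψ x) x :=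
    hψ.integral_hasStrictDerivAt 0 x |>.hasDerivAt
  refine (hprim.const_add (∫ s in Iic 0, ψ s)).congr_of_eventuallyEq (.of_forall fun y => ?_)
  simp only [← intervalIntegral.integral_Iic_sub_Iic hint.integrableOn hint.integrableOn,
    add_sub_cancel]

lemma IsTestFun.exists_deriv_eq (hΩ : Ω.OrdConnected) (hψ : IsTestFun Ω ψ)
    (h0 : ∫ x, ψ x = 0) : ∃ Ψ, IsTestFun Ω Ψ ∧ deriv Ψ = ψ := by
  obtain ⟨c, d, hcd, hΩcd⟩ := hψ.exists_tsupport_subset_Icc hΩ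
  have hψ0 : ∀ x ∉ Icc c d, ψ x = 0 := fun x hx =>
    image_eq_zero_of_notMem_tsupport fun h => hx (hcd h)
  have hderiv := hasDerivAt_integral_Iic hψ.1.continuous hψ.integrable
  set Ψ : ℝ → ℝ := fun x => ∫ s in Iic x, ψ s
  have hΨ : deriv Ψ = ψ := funext fun x => (hderiv x).deriv
  have hΨ0 : ∀ x ∉ Icc c d, Ψ x = 0 := fun x hx => by
    rcases lt_or_ge x c with hxc | hcx
    · exact setIntegral_eq_zero_of_forall_eq_zero fun s hs =>
        hψ0 s fun h => (hxc.trans_le h.1).not_ge hs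
    · refine (setIntegral_eq_integral_of_forall_compl_eq_zero fun s hs => ?_).trans h0
      exact hψ0 s fun h => hs (h.2.trans (not_le.1 fun hxd => hx ⟨hcx, hxd⟩).le)
  refine ⟨Ψ, ⟨contDiff_infty_iff_deriv.2 ⟨fun x => (hderiv x).differentiableAt, hΨ ▸ hψ.1⟩,
    HasCompactSupport.intro isCompact_Icc hΨ0, ?_⟩, hΨ⟩
  exact (closure_minimal (fun x hx => not_imp_comm.1 (hΨ0 x) hx) isClosed_Icc).trans hΩcd

lemma exists_isTestFun_integral_eq_one (hΩ : IsOpen Ω) (hne : Ω.Nonempty) :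
    ∃ ρ, IsTestFun Ω ρ ∧ ∫ x, ρ x = 1 := by
  obtain ⟨c, hc⟩ := hne
  obtain ⟨r, hr, hrΩ⟩ := Metric.nhds_basis_closedBall.mem_iff.1 (hΩ.mem_nhds hc)
  let bump : ContDiffBump c := ⟨r / 2, r, half_pos hr, half_lt_self hr⟩
  exact ⟨bump.normed volume, ⟨bump.contDiff_normed, bump.hasCompactSupport_normed,
    bump.tsupport_normed_eq.trans_subset hrΩ⟩, bump.integral_normed⟩

lemma IsTestFun.const_mul (hθ : IsTestFun Ω θ) (c : ℝ) : IsTestFun Ω (fun x => c * θ x) :=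
  ⟨contDiff_const.mul hθ.1, hθ.2.1.mul_left,
    (closure_mono (Function.support_mul_subset_right _ _)).trans hθ.2.2⟩

lemma IsTestFun.sub (hθ : IsTestFun Ω θ) (hψ : IsTestFun Ω ψ) : IsTestFun Ω (θ - ψ) :=
  ⟨hθ.1.sub hψ.1, hθ.2.1.sub hψ.2.1, (tsupport_sub θ ψ).trans (union_subset hθ.2.2 hψ.2.2)⟩

lemma HasWeakDeriv.exists_ae_eq_const (hΩ : IsOpen Ω) (hconn : Ω.OrdConnected) (hne : Ω.Nonempty)
    (hf : LocallyIntegrableOn f Ω) (h : HasWeakDeriv Ω (volume.restrict Ω) f 0) :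
    ∃ c, ∀ᵐ x, x ∈ Ω → f x = c := by
  obtain ⟨ρ, hρ, hρ1⟩ := exists_isTestFun_integral_eq_one hΩ hne
  refine ⟨∫ x, f x * ρ x, ae_eq_of_forall_integral_mul_eq hΩ hf
    ((locallyIntegrable_const _).locallyIntegrableOn Ω) fun ψ hψ => ?_⟩
  have hm : IsTestFun Ω fun x => (∫ x, ψ x) * ρ x := hρ.const_mul _
  obtain ⟨Ψ, hΨ, hderiv⟩ := (hψ.sub hm).exists_deriv_eq hconn <| by
    simp only [Pi.sub_apply]
    rw [integral_sub hψ.integrable hm.integrable, integral_const_mul, hρ1, mul_one, sub_self]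
  have horth : ∫ x, f x * (ψ x - (∫ x, ψ x) * ρ x) = 0 := by
    have hΨ0 := h Ψ hΨ
    rw [hderiv, setIntegral_eq_integral_of_forall_compl_eq_zero fun x hx => by
      rw [(hψ.sub hm).eq_zero_of_notMem hx, mul_zero]] at hΨ0
    simpa using hΨ0
  simp only [mul_sub] at horth
  rw [integral_sub (hψ.integrable_mul hf) (hm.integrable_mul hf), sub_eq_zero] at horth
  rw [horth, integral_const_mul, mul_comm, ← integral_const_mul]
  exact integral_congr_ae (.of_forall fun x => by ring)

theorem HasWeakDeriv.intervalIntegral_eq_sub {a b s t : ℝ} (hab : a < b)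
    (hf : ContinuousOn f (Icc a b)) (hg : IntegrableOn g (Ioo a b))
    (h : HasWeakDeriv (Ioo a b) (volume.restrict (Ioo a b)) f g)
    (hs : s ∈ Icc a b) (ht : t ∈ Icc a b) : ∫ x in s..t, g x = f t - f s := by
  have hgi : IntervalIntegrable g volume a b :=
    (intervalIntegrable_iff_integrableOn_Ioo_of_le hab.le).2 hg
  set p : ℝ → ℝ := fun x => ∫ y in a..x, g y with hp
  have hpc : ContinuousOn p (Icc a b) := by
    simpa only [uIcc_of_le hab.le] using
      (hgi.absolutelyContinuousOnInterval_intervalIntegral left_mem_uIcc).continuousOn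
  have hloc : ∀ {k : ℝ → ℝ}, IntegrableOn k (Ioo a b) →
      LocallyIntegrableOn k (Ioo a b) (volume.restrict (Ioo a b)) := fun hk =>
    hk.locallyIntegrable.locallyIntegrableOn _
  have hIoo : ∀ {k : ℝ → ℝ}, ContinuousOn k (Icc a b) → IntegrableOn k (Ioo a b) := fun hk =>
    hk.integrableOn_Icc.mono_set Ioo_subset_Icc_self
  have hweak : HasWeakDeriv (Ioo a b) (volume.restrict (Ioo a b)) (f - p) 0 := by
    simpa only [sub_self] using h.sub (hasWeakDeriv_intervalIntegral hab.le hgi) (hloc (hIoo hf))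
      (hloc (hIoo hpc)) (hloc hg) (hloc hg)
  obtain ⟨c, hc⟩ := hweak.exists_ae_eq_const isOpen_Ioo ordConnected_Ioo (nonempty_Ioo.2 hab)
    (hIoo (hf.sub hpc)).locallyIntegrableOn
  have heq : EqOn (f - p) (fun _ => c) (Icc a b) := by
    refine Measure.eqOn_Icc_of_ae_eq volume hab.ne ?_ (hf.sub hpc) continuousOn_const
    rwa [← restrict_Ioo_eq_restrict_Icc, EventuallyEq, ae_restrict_iff' measurableSet_Ioo]
  have hst := (heq hs).trans (heq ht).symm
  have hint : ∀ {x}, x ∈ Icc a b → IntervalIntegrable g volume a x := fun hx =>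
    hgi.mono_set (uIcc_subset_uIcc_left (Icc_subset_uIcc hx))
  rw [← intervalIntegral.integral_interval_sub_left (hint ht) (hint hs)]
  simp only [Pi.sub_apply, hp] at hst
  linarith

end WeakDerivative

section H1Space

variable {Ω : Set ℝ} {μ : Measure ℝ} [IsFiniteMeasureOnCompacts μ] {f g : ℝ → ℝ}

lemma H1Space.hasWeakDeriv (v : H1Space Ω μ) : HasWeakDeriv Ω μ (val v) (weakDeriv v) := v.2

lemma HasWeakDeriv.exists_H1Space (h : HasWeakDeriv Ω μ f g) (hf : MemLp f 2 μ)
    (hg : MemLp g 2 μ) : ∃ v : H1Space Ω μ, val v =ᵐ[μ] f ∧ weakDeriv v =ᵐ[μ] g :=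
  ⟨⟨WithLp.toLp 2 (hf.toLp f, hg.toLp g),
    h.congr_ae hf.coeFn_toLp.symm hg.coeFn_toLp.symm⟩, hf.coeFn_toLp, hg.coeFn_toLp⟩

/-- The embedding `H¹(Ω) → L²(Ω)` as a linear map. -/
def valₗ : H1Space Ω μ →ₗ[ℝ] Lp ℝ 2 μ where
  toFun := val
  map_add' _ _ := rfl
  map_smul' _ _ := rfl

lemma exists_V_of_contDiff (hf : ContDiff ℝ 1 f) (h : MemLp f 2) (h' : MemLp (deriv f) 2) :
    ∃ v : V, val v =ᵐ[volume] f := by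
  have hweak : HasWeakDeriv univ volume f (deriv f) := by
    simpa only [Measure.restrict_univ] using hasWeakDeriv_deriv univ hf
  obtain ⟨v, hv, -⟩ := hweak.exists_H1Space h h'
  exact ⟨v, hv⟩

lemma weakDeriv_ae_eq_deriv (hf : ContDiff ℝ 1 f) {v : V} (hv : val v =ᵐ[volume] f) :
    weakDeriv v =ᵐ[volume] deriv f := by
  have hweak : HasWeakDeriv univ volume f (deriv f) := by
    simpa only [Measure.restrict_univ] using hasWeakDeriv_deriv univ hf
  have hae := (v.hasWeakDeriv.congr_ae hv .rfl).ae_eq isOpen_univ hweak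
    (((Lp.memLp (weakDeriv v)).locallyIntegrable one_le_two).locallyIntegrableOn _)
    ((hf.continuous_deriv le_rfl).locallyIntegrable.locallyIntegrableOn _)
  filter_upwards [hae] with x hx using hx (mem_univ x)

lemma exists_H1Time_const (T c : ℝ) : ∃ u : H1Time T, val u =ᵐ[timeMeasure T] fun _ => c := by
  have hweak : HasWeakDeriv (Ioo 0 T) (timeMeasure T) (fun _ => c) fun _ => 0 := by
    simpa only [deriv_const'] using hasWeakDeriv_deriv (Ioo 0 T) (contDiff_const (c := c))
  obtain ⟨u, hu, -⟩ := hweak.exists_H1Space (memLp_const c) (memLp_const 0)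
  exact ⟨u, hu⟩

end H1Space

section Convection

lemma exists_norm_le_of_integrable_deriv {E : Type*} [NormedAddCommGroup E] [NormedSpace ℝ E]
    [CompleteSpace E] {g g' : ℝ → E} (hg : ∀ x, HasDerivAt g (g' x) x) (hg' : Integrable g') :
    ∃ C, ∀ x, ‖g x‖ ≤ C := by
  refine ⟨‖g 0‖ + ∫ x, ‖g' x‖, fun x => ?_⟩
  have hftc : g x = g 0 + ∫ t in (0 : ℝ)..x, g' t := by
    rw [intervalIntegral.integral_eq_sub_of_hasDerivAt (fun t _ => hg t) hg'.intervalIntegrable,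
      add_sub_cancel]
  rw [hftc]
  refine (norm_add_le _ _).trans (add_le_add_right ?_ _)
  exact intervalIntegral.norm_integral_le_integral_norm_uIoc.trans
    (setIntegral_le_integral hg'.norm (.of_forall fun _ => norm_nonneg _))

lemma integral_mul_deriv_mul_self_eq_zero {f f' : ℝ → ℝ} (hf : ∀ x, HasDerivAt f (f' x) x)
    (h : MemLp f 2) (h' : MemLp f' 2) : ∫ x, f x * f' x * f x = 0 := by
  have hff' : Integrable (fun x => f x * f' x) := h.integrable_mul h'
  obtain ⟨C, hC⟩ := exists_norm_le_of_integrable_deriv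
    (g := fun x => f x * f x) (g' := fun x => 2 * (f x * f' x))
    (fun x => ((hf x).fun_mul (hf x)).congr_deriv (by ring)) (hff'.const_mul 2)
  have hbdd : ∀ᵐ x, ‖f x‖ ≤ √C := .of_forall fun x =>
    Real.abs_le_sqrt (by simpa only [sq] using (le_abs_self _).trans (hC x))
  have hcube : Integrable (fun x => f x * f x * f x) :=
    (h.integrable_mul h).mul_bdd h.aestronglyMeasurable hbdd
  have hderiv : ∀ x, HasDerivAt (fun x => f x * f x * f x) (3 * (f x * f' x * f x)) x := fun x =>
    (((hf x).fun_mul (hf x)).fun_mul (hf x)).congr_deriv (by ring)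
  have hzero := integral_eq_zero_of_hasDerivAt_of_integrable hderiv
    ((hff'.mul_bdd h.aestronglyMeasurable hbdd).const_mul 3) hcube
  simpa [integral_const_mul] using hzero

lemma integral_convection_eq_zero {f : ℝ → ℝ} (hf : ContDiff ℝ 1 f) {v : V}
    (hv : val v =ᵐ[volume] f) : ∫ x, val v x * weakDeriv v x * val v x = 0 := by
  have hv' := weakDeriv_ae_eq_deriv hf hv
  rw [← integral_mul_deriv_mul_self_eq_zero
    (fun x => (hf.differentiable one_ne_zero x).hasDerivAt) ((Lp.memLp (val v)).ae_eq hv)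
    ((Lp.memLp (weakDeriv v)).ae_eq hv')]
  refine integral_congr_ae ?_
  filter_upwards [hv, hv'] with x hx hx'
  rw [hx, hx']

end Convection

section Translation

variable {E F : Type*} [NormedAddCommGroup E] [NormedAddCommGroup F]

lemma memLp_comp_add_right {p : ℝ≥0∞} {f : ℝ → E} (hf : MemLp f p) (z : ℝ) :
    MemLp (fun t => f (t + z)) p :=
  hf.comp_measurePreserving (measurePreserving_add_right volume z)

lemma continuous_toLp_comp_add_right {p : ℝ≥0∞} [Fact (1 ≤ p)] (hp : p ≠ ⊤) {f : ℝ → E}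
    (hf : MemLp f p) : Continuous fun z => (memLp_comp_add_right hf z).toLp :=
  let g : C(ℝ, C(ℝ, ℝ)) := (ContinuousMap.mk fun a : ℝ × ℝ => a.2 + a.1).curry
  (continuous_const (y := hf.toLp f)).compMeasurePreservingLp g.continuous
    (fun z => measurePreserving_add_right volume z) hp

variable [NormedSpace ℝ E] [NormedSpace ℝ F]

lemma integrable_clm_apply {α : Type*} {_ : MeasurableSpace α} {μ : Measure α}
    {f : α → E →L[ℝ] F} {y : α → E} (hf : MemLp f 2 μ) (hy : MemLp y 2 μ) :
    Integrable (fun t => f t (y t)) μ :=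
  memLp_one_iff_integrable.1
    (ContinuousLinearMap.memLp_of_bilin 1 (ContinuousLinearMap.id ℝ (E →L[ℝ] F)) hf hy)

variable {f : ℝ → E →L[ℝ] ℝ} {y : ℝ → E}

lemma continuous_integral_translate (hf : MemLp f 2) (hy : MemLp y 2) (s : Set ℝ) :
    Continuous fun p : ℝ × ℝ => ∫ t in s, f (t + p.1) (y (t + p.2)) := by
  have hf' := (LpToLpRestrictCLM ℝ (E →L[ℝ] ℝ) ℝ volume 2 s).continuous.comp
    ((continuous_toLp_comp_add_right ENNReal.ofNat_ne_top hf).comp continuous_fst (X := ℝ × ℝ))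
  have hy' := (LpToLpRestrictCLM ℝ E ℝ volume 2 s).continuous.comp
    ((continuous_toLp_comp_add_right ENNReal.ofNat_ne_top hy).comp continuous_snd (X := ℝ × ℝ))
  refine (((ContinuousLinearMap.id ℝ (E →L[ℝ] ℝ)).lpPairing (volume.restrict s) 2
    2).continuous.comp hf').clm_apply hy' |>.congr fun p => ?_
  simp only [Function.comp_apply, ContinuousLinearMap.lpPairing_eq_integral]
  refine integral_congr_ae ?_
  filter_upwards [LpToLpRestrictCLM_coeFn ℝ s (memLp_comp_add_right hf p.1).toLp,
    LpToLpRestrictCLM_coeFn ℝ s (memLp_comp_add_right hy p.2).toLp,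
    ae_restrict_of_ae (memLp_comp_add_right hf p.1).coeFn_toLp,
    ae_restrict_of_ae (memLp_comp_add_right hy p.2).coeFn_toLp] with t hft hyt hft' hyt'
  rw [hft, hyt, hft', hyt', ContinuousLinearMap.id_apply]

lemma intervalIntegral_integral_translate_swap (hf : MemLp f 2) (hy : MemLp y 2) (a b h : ℝ)
    (s : Set ℝ) :
    ∫ r in a..b, ∫ t in s, f (t + h * r) (y t) = ∫ t in s, ∫ r in a..b, f (t + h * r) (y t) := by
  have hshear : MeasurePreserving (fun p : ℝ × ℝ => (p.1, p.2 + h * p.1))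
      ((volume.restrict (uIoc a b)).prod volume) ((volume.restrict (uIoc a b)).prod volume) :=
    (MeasurePreserving.id _).skew_product (g := fun r t => t + h * r) (by fun_prop)
      (.of_forall fun r => (measurePreserving_add_right volume (h * r)).map_eq)
  have : IsFiniteMeasure (volume.restrict (uIoc a b)) :=
    inferInstanceAs (IsFiniteMeasure (volume.restrict (Ioc _ _)))
  have hint := integrable_clm_apply ((hf.comp_snd _).comp_measurePreserving hshear)
    (hy.comp_snd (volume.restrict (uIoc a b)))
  exact intervalIntegral_integral_swap
    (hint.mono_measure (Measure.prod_mono le_rfl Measure.restrict_le_self))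

lemma tendsto_integral_average_translate (hf : MemLp f 2) (hy : MemLp y 2) (s : Set ℝ) :
    Tendsto (fun h => ∫ t in s, ∫ r in (0 : ℝ)..1, f (t + h * r) (y (t + h) + y t)) (𝓝 0)
      (𝓝 (2 * ∫ t in s, f t (y t))) := by
  have hc := continuous_integral_translate hf hy s
  have hcont : Continuous fun h : ℝ => ∫ r in (0 : ℝ)..1,
      ((∫ t in s, f (t + h * r) (y (t + h))) + ∫ t in s, f (t + h * r) (y (t + 0))) := by
    refine intervalIntegral.continuous_parametric_intervalIntegral_of_continuous' ?_ 0 1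
    exact (hc.comp (by fun_prop : Continuous fun p : ℝ × ℝ => (p.1 * p.2, p.1))).add
      (hc.comp (by fun_prop : Continuous fun p : ℝ × ℝ => (p.1 * p.2, (0 : ℝ))))
  have hlim := hcont.tendsto 0
  simp only [zero_mul, add_zero, intervalIntegral.integral_const, sub_zero, one_smul,
    ← two_mul] at hlim
  refine hlim.congr fun h => ?_
  have hyh := memLp_comp_add_right hy h
  refine Eq.trans (intervalIntegral.integral_congr fun r _ => ?_)
    (intervalIntegral_integral_translate_swap hf (hyh.add hy) 0 1 h s)
  have hfr := (memLp_comp_add_right hf (h * r)).restrict s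
  simp only [Pi.add_apply, map_add]
  exact (integral_add (integrable_clm_apply hfr (hyh.restrict s))
    (integrable_clm_apply hfr (hy.restrict s))).symm

lemma tendsto_average_difference [CompleteSpace E] {g : ℝ → E} (hg : Continuous g) (a b : ℝ) :
    Tendsto (fun h => h⁻¹ • ∫ t in a..b, (g (t + h) - g t)) (𝓝[>] 0) (𝓝 (g b - g a)) := by
  have hderiv : ∀ x, HasDerivAt (fun x => ∫ t in (0 : ℝ)..x, g t) (g x) x := fun x =>
    (hg.integral_hasStrictDerivAt 0 x).hasDerivAt
  refine ((hderiv b).tendsto_slope_zero_right.sub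
    (hderiv a).tendsto_slope_zero_right).congr fun h => ?_
  have hi : ∀ a b, IntervalIntegrable g volume a b := hg.intervalIntegrable
  have hi' : IntervalIntegrable (fun t => g (t + h)) volume a b :=
    (hg.comp (continuous_add_const h)).intervalIntegrable a b
  rw [intervalIntegral.integral_sub hi' (hi a b), intervalIntegral.integral_comp_add_right,
    ← intervalIntegral.integral_interval_sub_left (hi 0 (b + h)) (hi 0 (a + h)),
    ← intervalIntegral.integral_interval_sub_left (hi 0 b) (hi 0 a), ← smul_sub]
  congr 1
  abel

end Translation

section Energy

lemma exists_continuous_eqOn_Icc {X : Type*} [TopologicalSpace X] {a b : ℝ} (hab : a ≤ b)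
    {w : ℝ → X} (hw : ContinuousOn w (Icc a b)) : ∃ w', Continuous w' ∧ EqOn w' w (Icc a b) :=
  ⟨IccExtend hab ((Icc a b).domRestrict w),
    (continuousOn_iff_continuous_domRestrict.1 hw).Icc_extend', fun _ => IccExtend_of_mem hab _⟩

lemma exists_memLp_eqOn {α G : Type*} {_ : MeasurableSpace α} {μ : Measure α}
    [NormedAddCommGroup G] {p : ℝ≥0∞} {s : Set α} (hs : MeasurableSet s) {f : α → G}
    (hf : MemLp f p (μ.restrict s)) : ∃ f', MemLp f' p μ ∧ EqOn f' f s :=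
  ⟨s.indicator f, (memLp_indicator_iff_restrict hs).2 hf, fun _ hx => indicator_of_mem hx f⟩

variable {E F : Type*} [NormedAddCommGroup E] [NormedSpace ℝ E] [NormedAddCommGroup F]
  [InnerProductSpace ℝ F] {ι : E →ₗ[ℝ] F} {a b s t : ℝ} {f : ℝ → E →L[ℝ] ℝ} {y : ℝ → E} {w : ℝ → F}

lemma norm_sq_sub_norm_sq_eq_intervalIntegral {x z : E}
    (hd : ∀ v, inner ℝ (w t) (ι v) - inner ℝ (w s) (ι v) = ∫ τ in s..t, f τ v)
    (hs : w s = ι x) (ht : w t = ι z) : ‖w t‖ ^ 2 - ‖w s‖ ^ 2 = ∫ τ in s..t, f τ (z + x) := by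
  rw [← hd, map_add, ← hs, ← ht, inner_add_right, inner_add_right, real_inner_self_eq_norm_sq,
    real_inner_self_eq_norm_sq, real_inner_comm]
  ring

lemma norm_sq_sub_norm_sq_eq_of_continuous (hy : MemLp y 2) (hf : MemLp f 2) (hw : Continuous w)
    (hwy : ∀ᵐ τ, τ ∈ Ioo a b → w τ = ι (y τ))
    (hd : ∀ v, ∀ s ∈ Ioo a b, ∀ t ∈ Ioo a b,
      inner ℝ (w t) (ι v) - inner ℝ (w s) (ι v) = ∫ τ in s..t, f τ v)
    (ht : t ∈ Ico a b) : ‖w t‖ ^ 2 - ‖w a‖ ^ 2 = 2 * ∫ τ in a..t, f τ (y τ) := by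
  rw [intervalIntegral.integral_of_le ht.1]
  refine tendsto_nhds_unique (tendsto_average_difference (hw.norm.pow 2) a t)
    (((tendsto_integral_average_translate hf hy (Ioc a t)).mono_left nhdsWithin_le_nhds).congr' ?_)
  filter_upwards [Ioo_mem_nhdsGT (sub_pos.2 ht.2)] with h hh
  rw [intervalIntegral.integral_of_le ht.1, ← integral_smul]
  refine setIntegral_congr_ae measurableSet_Ioc ?_
  filter_upwards [hwy, (measurePreserving_add_right volume h).quasiMeasurePreserving.ae hwy]
    with τ hτ hτh hmem
  have hmemτ : τ ∈ Ioo a b := ⟨hmem.1, hmem.2.trans_lt ht.2⟩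
  have hmemτh : τ + h ∈ Ioo a b := ⟨by linarith [hmem.1, hh.1], by linarith [hmem.2, hh.2]⟩
  simp only [Pi.pow_apply]
  rw [norm_sq_sub_norm_sq_eq_intervalIntegral (hd · τ hmemτ (τ + h) hmemτh) (hτ hmemτ)
    (hτh hmemτh), intervalIntegral.integral_comp_add_mul (fun r => f r _) hh.1.ne']
  simp only [mul_zero, add_zero, mul_one]

lemma norm_sq_sub_norm_sq_eq_of_mem_Ico (hy : MemLp y 2 (volume.restrict (Ioo a b)))
    (hf : MemLp f 2 (volume.restrict (Ioo a b))) (hw : ContinuousOn w (Icc a b))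
    (hwy : ∀ᵐ τ ∂volume.restrict (Ioo a b), w τ = ι (y τ))
    (hd : ∀ v, ∀ s ∈ Ioo a b, ∀ t ∈ Ioo a b,
      inner ℝ (w t) (ι v) - inner ℝ (w s) (ι v) = ∫ τ in s..t, f τ v)
    (ht : t ∈ Ico a b) : ‖w t‖ ^ 2 - ‖w a‖ ^ 2 = 2 * ∫ τ in a..t, f τ (y τ) := by
  have hab : a ≤ b := ht.1.trans ht.2.le
  obtain ⟨w', hw', hww'⟩ := exists_continuous_eqOn_Icc hab hw
  obtain ⟨y', hy', hyy'⟩ := exists_memLp_eqOn measurableSet_Ioo hy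
  obtain ⟨f', hf', hff'⟩ := exists_memLp_eqOn measurableSet_Ioo hf
  have henergy : ‖w' t‖ ^ 2 - ‖w' a‖ ^ 2 = 2 * ∫ τ in a..t, f' τ (y' τ) := by
    refine norm_sq_sub_norm_sq_eq_of_continuous (ι := ι) hy' hf' hw' ?_ (fun v s hs t ht => ?_) ht
    · filter_upwards [(ae_restrict_iff' measurableSet_Ioo).1 hwy] with τ hτ hmem
      rw [hww' (Ioo_subset_Icc_self hmem), hτ hmem, hyy' hmem]
    · rw [hww' (Ioo_subset_Icc_self hs), hww' (Ioo_subset_Icc_self ht), hd v s hs t ht]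
      refine intervalIntegral.integral_congr fun τ hτ => ?_
      rw [hff' (ordConnected_Ioo.uIcc_subset hs ht hτ)]
  rw [← hww' (Ico_subset_Icc_self ht), ← hww' (left_mem_Icc.2 hab), henergy,
    intervalIntegral.integral_of_le ht.1, intervalIntegral.integral_of_le ht.1]
  congr 1
  refine setIntegral_congr_fun measurableSet_Ioc fun τ hτ => ?_
  have hmem : τ ∈ Ioo a b := ⟨hτ.1, hτ.2.trans_lt ht.2⟩
  simp only [hff' hmem, hyy' hmem]

theorem norm_sq_sub_norm_sq_eq_integral (hab : a < b)
    (hy : MemLp y 2 (volume.restrict (Ioo a b))) (hf : MemLp f 2 (volume.restrict (Ioo a b)))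
    (hw : ContinuousOn w (Icc a b)) (hwy : ∀ᵐ τ ∂volume.restrict (Ioo a b), w τ = ι (y τ))
    (hd : ∀ v, HasWeakDeriv (Ioo a b) (volume.restrict (Ioo a b))
      (fun τ => inner ℝ (ι (y τ)) (ι v)) (fun τ => f τ v))
    (ht : t ∈ Icc a b) : ‖w t‖ ^ 2 - ‖w a‖ ^ 2 = 2 * ∫ τ in a..t, f τ (y τ) := by
  have hincr : ∀ v, ∀ s ∈ Ioo a b, ∀ t ∈ Ioo a b,
      inner ℝ (w t) (ι v) - inner ℝ (w s) (ι v) = ∫ τ in s..t, f τ v := fun v s hs t ht => by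
    have hweak : HasWeakDeriv (Ioo a b) (volume.restrict (Ioo a b))
        (fun τ => inner ℝ (w τ) (ι v)) (fun τ => f τ v) :=
      (hd v).congr_ae (hwy.mono fun τ hτ => by simp only [hτ]) .rfl
    exact (hweak.intervalIntegral_eq_sub hab (hw.inner continuousOn_const)
      ((hf.integrable one_le_two).apply_continuousLinearMap v) (Ioo_subset_Icc_self hs)
      (Ioo_subset_Icc_self ht)).symm
  have hint : IntervalIntegrable (fun τ => f τ (y τ)) volume a b :=
    (intervalIntegrable_iff_integrableOn_Ioo_of_le hab.le).2 (integrable_clm_apply hf hy)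
  have hcont : ContinuousOn (fun t => ∫ τ in a..t, f τ (y τ)) (Icc a b) := by
    simpa only [uIcc_of_le hab.le] using
      (hint.absolutelyContinuousOnInterval_intervalIntegral left_mem_uIcc).continuousOn
  have hIco : EqOn (fun t => ‖w t‖ ^ 2 - ‖w a‖ ^ 2) (fun t => 2 * ∫ τ in a..t, f τ (y τ))
      (Ico a b) := fun t ht => norm_sq_sub_norm_sq_eq_of_mem_Ico hy hf hw hwy hincr ht
  exact hIco.of_subset_closure ((hw.norm.pow 2).sub continuousOn_const)
    (continuousOn_const.mul hcont) Ico_subset_Icc_self (closure_Ico hab.ne).ge ht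

lemma le_add_of_sq_le_sq_add_integral {φ ρ : ℝ → ℝ} {M : ℝ} (hab : a ≤ b) (hM : 0 ≤ M)
    (hφ : ContinuousOn φ (Icc a b)) (hφ0 : ∀ t ∈ Icc a b, 0 ≤ φ t)
    (hρ : IntegrableOn ρ (Ioo a b)) (hρφ : ∀ᵐ t ∂volume.restrict (Ioo a b), ρ t ≤ M * φ t)
    (h : ∀ t ∈ Icc a b, φ t ^ 2 ≤ φ a ^ 2 + 2 * ∫ τ in a..t, ρ τ) (ht : t ∈ Icc a b) :
    φ t ≤ φ a + 2 * M * (b - a) := by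
  obtain ⟨m, hm, hmax⟩ := isCompact_Icc.exists_isMaxOn (nonempty_Icc.2 hab) hφ
  refine (hmax ht).trans ?_
  have hgrowth : ∫ τ in a..m, ρ τ ≤ (b - a) * (M * φ m) := by
    have hsub : Ioo a m ⊆ Ioo a b := Ioo_subset_Ioo_right hm.2
    calc ∫ τ in a..m, ρ τ ≤ ∫ _ in a..m, M * φ m := by
          rw [intervalIntegral.integral_of_le hm.1, intervalIntegral.integral_of_le hm.1,
            integral_Ioc_eq_integral_Ioo, integral_Ioc_eq_integral_Ioo]
          refine setIntegral_mono_ae_restrict (hρ.mono_set hsub) (integrable_const _) ?_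
          filter_upwards [ae_restrict_of_ae_restrict_of_subset hsub hρφ,
            ae_restrict_mem measurableSet_Ioo] with τ hτ hmem
          exact hτ.trans (mul_le_mul_of_nonneg_left (hmax (Ioo_subset_Icc_self (hsub hmem))) hM)
      _ = (m - a) * (M * φ m) := by rw [intervalIntegral.integral_const, smul_eq_mul]
      _ ≤ (b - a) * (M * φ m) := by gcongr; exacts [mul_nonneg hM (hφ0 m hm), hm.2]
  have hφa : φ a ≤ φ m := hmax (left_mem_Icc.2 hab)
  have hφa0 : 0 ≤ φ a := hφ0 a (left_mem_Icc.2 hab)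
  rcases (hφ0 m hm).eq_or_lt with hzero | hpos
  · rw [← hzero]
    have := sub_nonneg.2 hab
    positivity
  · refine le_of_mul_le_mul_right ?_ hpos
    nlinarith [h m hm, mul_le_mul_of_nonneg_left hφa hφa0]

end Energy

namespace W

variable {T : ℝ} (y : W T)

lemma norm_sq_traj_sub_eq_integral (hT : 0 < T) {t : ℝ} (ht : t ∈ Icc 0 T) :
    ‖y.traj t‖ ^ 2 - ‖y.traj 0‖ ^ 2 = 2 * ∫ τ in (0 : ℝ)..t, y.dt τ (y.toV τ) :=
  norm_sq_sub_norm_sq_eq_integral (ι := valₗ) hT y.memLp_toV y.memLp_dt y.continuousOn_traj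
    y.traj_eq y.weak_dt ht

lemma norm_traj_le (hT : 0 < T) {M : ℝ} (hM : 0 ≤ M)
    (h : ∀ᵐ t ∂timeMeasure T, y.dt t (y.toV t) ≤ M * ‖y.traj t‖) {t : ℝ} (ht : t ∈ Icc 0 T) :
    ‖y.traj t‖ ≤ ‖y.traj 0‖ + 2 * M * T := by
  have hgrowth := le_add_of_sq_le_sq_add_integral hT.le hM y.continuousOn_traj.norm
    (fun t _ => norm_nonneg (y.traj t)) (integrable_clm_apply y.memLp_dt y.memLp_toV) h
    (fun t ht => by linarith [y.norm_sq_traj_sub_eq_integral hT ht]) ht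
  rwa [sub_zero] at hgrowth

end W

section Particle

variable {ζ δ : ℝ → ℝ} {n : ℕ∞ω} {p : ℝ≥0∞}

lemma contDiff_dilate (hζ : ContDiff ℝ n ζ) (ε : ℝ) : ContDiff ℝ n (dilate ζ ε) :=
  contDiff_const.mul (hζ.comp (contDiff_const.mul contDiff_id))

lemma memLp_dilate (hζ : MemLp ζ p) {ε : ℝ} (hε : ε ≠ 0) : MemLp (dilate ζ ε) p := by
  refine MemLp.const_mul (MemLp.comp_of_map ?_ (measurable_const_mul ε⁻¹).aemeasurable) ε⁻¹
  rw [Real.map_volume_mul_left (inv_ne_zero hε)]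
  exact hζ.smul_measure ENNReal.ofReal_ne_top

lemma deriv_dilate (ζ : ℝ → ℝ) (ε : ℝ) :
    deriv (dilate ζ ε) = fun x => ε⁻¹ * dilate (deriv ζ) ε x := by
  ext x
  rw [show dilate ζ ε = fun x => ε⁻¹ * ζ (ε⁻¹ * x) from rfl, deriv_const_mul_field,
    deriv_comp_mul_left, smul_eq_mul, dilate]

variable {N : ℕ} (a ξ : Fin N → ℝ)

lemma contDiff_particleFun (hδ : ContDiff ℝ n δ) : ContDiff ℝ n (particleFun δ a ξ) :=
  ContDiff.sum fun _ _ => contDiff_const.mul (hδ.comp (contDiff_id.sub contDiff_const))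

lemma memLp_particleFun (hδ : MemLp δ p) : MemLp (particleFun δ a ξ) p :=
  memLp_finsetSum _ fun i _ =>
    (hδ.comp_measurePreserving (measurePreserving_sub_right volume (ξ i))).const_mul (a i)

lemma deriv_particleFun (hδ : Differentiable ℝ δ) :
    deriv (particleFun δ a ξ) = particleFun (deriv δ) a ξ := by
  ext x
  refine HasDerivAt.deriv (HasDerivAt.fun_sum fun i _ => HasDerivAt.const_mul (a i) ?_)
  exact (hδ _).hasDerivAt.comp_sub_const x (ξ i)

namespace ParticleScheme

variable {h : ℝ} (S : ParticleScheme h) (a ξ : Fin S.N → ℝ)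

lemma contDiff_one_particleFun : ContDiff ℝ 1 (particleFun (dilate S.ζ S.ε) a ξ) :=
  contDiff_particleFun a ξ (contDiff_dilate (S.ζ_smooth.of_le (by simp)) S.ε)

lemma exists_V_particleFun : ∃ v : V, val v =ᵐ[volume] particleFun (dilate S.ζ S.ε) a ξ := by
  have hε : S.ε ≠ 0 := S.ε_pos.ne'
  refine exists_V_of_contDiff (S.contDiff_one_particleFun a ξ)
    (memLp_particleFun a ξ (memLp_dilate S.ζ_memLp hε)) ?_
  rw [deriv_particleFun a ξ ((contDiff_dilate S.ζ_smooth S.ε).differentiable (by simp)),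
    deriv_dilate]
  exact memLp_particleFun a ξ ((memLp_dilate S.ζ_memLp_deriv hε).const_mul _)

end ParticleScheme

end Particle

namespace ControlProblem

variable (P : ControlProblem)

/-- The localisation function `χ` as an element of `H`. -/
def χH : H := (P.χ_smooth.continuous.memLp_of_hasCompactSupport P.χ_supp).toLp P.χ

lemma integral_χ_mul (f : H) : ∫ x, P.χ x * f x = inner ℝ P.χH f := by
  rw [L2.inner_def]
  refine integral_congr_ae ?_
  filter_upwards [MemLp.coeFn_toLp (P.χ_smooth.continuous.memLp_of_hasCompactSupport P.χ_supp)]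
    with x hx
  rw [χH, hx, RCLike.inner_apply, conj_trivial, mul_comm]

/-- A bound for the absolute values of all admissible controls. -/
def controlBound : ℝ := max |P.ul| |P.uu|

lemma controlBound_nonneg : 0 ≤ P.controlBound := (abs_nonneg _).trans (le_max_left _ _)

lemma exists_mem_Uad : ∃ u, u ∈ P.Uad := by
  obtain ⟨u, hu⟩ := exists_H1Time_const P.T P.ul
  exact ⟨u, hu.mono fun t ht => ⟨ht.ge, ht.le.trans P.ul_le_uu⟩⟩

variable {P} {y : W P.T} {u : H1Time P.T}

lemma ae_abs_le_controlBound (hu : u ∈ P.Uad) :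
    ∀ᵐ t ∂timeMeasure P.T, |val u t| ≤ P.controlBound :=
  Filter.Eventually.mono hu fun _ ht => abs_le_max_abs_abs ht.1 ht.2

lemma BurgersAt.dt_apply_self_le {t : ℝ} (h : P.BurgersAt y u t (y.toV t))
    (hconv : ∫ x, val (y.toV t) x * weakDeriv (y.toV t) x * val (y.toV t) x = 0) :
    y.dt t (y.toV t) ≤ |val u t| * (‖P.χH‖ * ‖val (y.toV t)‖) := by
  have hdissip : 0 ≤ P.ν * inner ℝ (weakDeriv (y.toV t)) (weakDeriv (y.toV t)) :=
    mul_nonneg P.ν_pos.le real_inner_self_nonneg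
  rw [BurgersAt, hconv, add_zero, integral_χ_mul] at h
  calc y.dt t (y.toV t) ≤ val u t * inner ℝ P.χH (val (y.toV t)) := by linarith
    _ ≤ |val u t| * |inner ℝ P.χH (val (y.toV t))| := (le_abs_self _).trans (abs_mul _ _).le
    _ ≤ |val u t| * (‖P.χH‖ * ‖val (y.toV t)‖) := by
      gcongr
      exact abs_real_inner_le_norm _ _

section Discrete

variable {h : ℝ} {S : ParticleScheme h} {Φ : Fin S.N → ℝ → ℝ}

namespace IsDiscreteState

lemma norm_traj_zero_le (hy : P.IsDiscreteState S y Φ u) : ‖y.traj 0‖ ≤ ‖val P.y0‖ := by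
  obtain ⟨-, ⟨α, hα, hΦ⟩, -, hinit⟩ := hy
  have h0 : (0 : ℝ) ∈ Icc 0 P.T := left_mem_Icc.2 P.T_pos.le
  have hX : (fun i => Φ i 0) = S.X := funext fun i => by simpa using (hΦ i).2 0 h0
  have hα0 := hα 0 h0
  rw [hX] at hα0
  obtain ⟨v, hv⟩ := S.exists_V_particleFun (fun i => α i 0) S.X
  have hvy : val v = y.traj 0 := Lp.ext (hv.trans hα0.symm)
  have hproj : ‖y.traj 0‖ * ‖y.traj 0‖ ≤ ‖val P.y0‖ * ‖y.traj 0‖ := by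
    rw [← real_inner_self_eq_norm_mul_norm]
    simpa only [hvy] using (hinit v (S.particle_mem_test _ _ v hv)).trans_le
      (real_inner_le_norm (val P.y0) (val v))
  rcases (norm_nonneg (y.traj 0)).eq_or_lt with hzero | hpos
  · exact hzero.symm.trans_le (norm_nonneg _)
  · exact le_of_mul_le_mul_right hproj hpos

-- The state is itself an admissible test function, and it is smooth enough for its convection
-- term to vanish.
lemma dt_apply_self_le (hy : P.IsDiscreteState S y Φ u) (hu : u ∈ P.Uad) :
    ∀ᵐ t ∂timeMeasure P.T, y.dt t (y.toV t) ≤ P.controlBound * ‖P.χH‖ * ‖y.traj t‖ := by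
  obtain ⟨-, ⟨α, hα, -⟩, hB, -⟩ := hy
  filter_upwards [hB, ae_abs_le_controlBound hu, y.traj_eq, ae_restrict_mem measurableSet_Ioo]
    with t hBt hut htraj ht
  have hparticle := hα t (Ioo_subset_Icc_self ht)
  rw [htraj] at hparticle
  have henergy := (hBt _ (S.particle_mem_test _ _ _ hparticle)).dt_apply_self_le
    (integral_convection_eq_zero (S.contDiff_one_particleFun _ _) hparticle)
  rw [htraj, mul_assoc]
  exact henergy.trans (by gcongr)

lemma norm_traj_le (hy : P.IsDiscreteState S y Φ u) (hu : u ∈ P.Uad) {t : ℝ}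
    (ht : t ∈ Icc 0 P.T) :
    ‖y.traj t‖ ≤ ‖val P.y0‖ + 2 * (P.controlBound * ‖P.χH‖) * P.T :=
  (y.norm_traj_le P.T_pos (mul_nonneg P.controlBound_nonneg (norm_nonneg _))
    (hy.dt_apply_self_le hu) ht).trans (add_le_add_left hy.norm_traj_zero_le _)

end IsDiscreteState

end Discrete

lemma norm_le_sqrt_of_J_le {B : ℝ} (h : P.J y u ≤ B) : ‖u‖ ≤ √(2 * B / P.σ) := by
  have hmisfit : 0 ≤ 1 / 2 * ‖y.traj P.T - P.yd‖ ^ 2 := by positivity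
  refine Real.le_sqrt_of_sq_le ((le_div_iff₀ P.σ_pos).2 ?_)
  rw [J] at h
  linarith

variable (P)

lemma exists_forall_isSolution_J_le : ∃ B, ∀ y u, P.IsSolution y u → P.J y u ≤ B := by
  by_cases hex : ∃ y u, P.IsSolution y u
  · obtain ⟨y₀, u₀, hu₀, hy₀, -⟩ := hex
    exact ⟨P.J y₀ u₀, fun y u hyu => hyu.2.2 y₀ u₀ hu₀ hy₀⟩
  · exact ⟨0, fun y u hyu => (hex ⟨y, u, hyu⟩).elim⟩

lemma exists_forall_isDiscreteSolution_J_le :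
    ∃ B, ∀ (h : ℝ) (S : ParticleScheme h), P.DiscreteSolvable S →
      ∀ y Φ u, P.IsDiscreteSolution S y Φ u → P.J y u ≤ B := by
  obtain ⟨u₀, hu₀⟩ := P.exists_mem_Uad
  refine ⟨1 / 2 * (‖val P.y0‖ + 2 * (P.controlBound * ‖P.χH‖) * P.T + ‖P.yd‖) ^ 2
    + P.σ / 2 * ‖u₀‖ ^ 2, fun h S hS y Φ u hyu => ?_⟩
  obtain ⟨y₀, Φ₀, hy₀⟩ := hS u₀ hu₀
  refine (hyu.2.2 y₀ Φ₀ u₀ hu₀ hy₀).trans ?_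
  rw [J]
  gcongr
  exact (norm_sub_le _ _).trans
    (add_le_add_left (hy₀.norm_traj_le hu₀ (right_mem_Icc.2 P.T_pos.le)) _)

end ControlProblem

end BurgersControl

end

theorem mainTheorem12 (P : BurgersControl.ControlProblem) :
    ∃ C : ℝ, 0 < C ∧
      (∀ (y : BurgersControl.W P.T) (u : BurgersControl.H1Time P.T),
        P.IsSolution y u → ‖u‖ ≤ C) ∧
      ∀ (h : ℝ), 0 < h → ∀ S : BurgersControl.ParticleScheme h, P.DiscreteSolvable S →
        ∀ (y : BurgersControl.W P.T) (Φ : Fin S.N → ℝ → ℝ) (u : BurgersControl.H1Time P.T),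
          P.IsDiscreteSolution S y Φ u → ‖u‖ ≤ C := by
  obtain ⟨B₁, hB₁⟩ := P.exists_forall_isSolution_J_le
  obtain ⟨B₂, hB₂⟩ := P.exists_forall_isDiscreteSolution_J_le
  have hbound : ∀ (y : BurgersControl.W P.T) (u : BurgersControl.H1Time P.T),
      P.J y u ≤ max B₁ B₂ → ‖u‖ ≤ √(2 * max B₁ B₂ / P.σ) + 1 := fun _ _ hJ =>
    (BurgersControl.ControlProblem.norm_le_sqrt_of_J_le hJ).trans
      (le_add_of_nonneg_right zero_le_one)
  refine ⟨√(2 * max B₁ B₂ / P.σ) + 1, by positivity, ?_, ?_⟩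
  · exact fun y u hyu => hbound y u ((hB₁ y u hyu).trans (le_max_left _ _))
  · exact fun h _ S hS y Φ u hyu => hbound y u ((hB₂ h S hS y Φ u hyu).trans (le_max_right _ _))
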